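/- Let $q,a,b,c\in\mathbb{C}$ be nonzero with $q^m\neq 1$ for all $m=1,2,\dots$. Let $\mathcal{H}_{\rm V}$ be the associative unital $\mathbb{C}$-algebra with generators $T_0,T_1,X,X^{-1}$ and defining relations $XX^{-1}=X^{-1}X=1$ and $$(T_1+ab)(T_1+1)=0,\qquad T_0(T_0+1)=0,\qquad (T_1X+a)(T_1X+b)=0,\qquad qT_0X^{-1}+c=X(T_0+1).$$ Then $\mathcal{H}_{\rm V}$ has a faithful representation on the space $\mathbb{C}[z,z^{-1}]$ of Laurent polynomials $f[z]$ (that is, there is an injective $\mathbb{C}$-algebra homomorphism $\mathcal{H}_{\rm V}\to\operatorname{End}_{\mathbb{C}}\mathbb{C}[z,z^{-1}]$) in which the generators act by $$(T_0f)[z]=\frac{(z-c)z}{q-z^2}\left(f[z]-f[qz^{-1}]\right),$$ $$(T_1f)[z]=\frac{(a+b)z-(1+ab)}{1-z^2}\,f[z]+\frac{(1-az)(1-bz)}{1-z^2}\,f[z^{-1}],$$ $$(Xf)[z]=z\,f[z].$$ -/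

import Mathlib

open scoped LaurentPolynomial

namespace ConfluentCherednik

noncomputable section

/-- The symbols `T₀`, `T₁`, `X`, `X⁻¹` generating the algebra. -/
inductive Gen : Type
  | t0
  | t1
  | x
  | xinv

/-- The letter of the free complex algebra attached to a generator. -/
def letter (g : Gen) : FreeAlgebra ℂ Gen := FreeAlgebra.ι ℂ g

/-- A scalar, seen in the free algebra. -/
def scal (k : ℂ) : FreeAlgebra ℂ Gen := algebraMap ℂ (FreeAlgebra ℂ Gen) k

open Gen in
/-- The defining relations of the confluent Cherednik algebra of type V:
`X X⁻¹ = 1 = X⁻¹ X`, `(T₁ + ab)(T₁ + 1) = 0`, `T₀ (T₀ + 1) = 0`,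
`(T₁ X + a)(T₁ X + b) = 0`, `q T₀ X⁻¹ + c = X (T₀ + 1)`. -/
inductive Rel (q a b c : ℂ) : FreeAlgebra ℂ Gen → FreeAlgebra ℂ Gen → Prop
  | x_mul_xinv : Rel q a b c (letter x * letter xinv) 1
  | xinv_mul_x : Rel q a b c (letter xinv * letter x) 1
  | quad_t1 : Rel q a b c ((letter t1 + scal (a * b)) * (letter t1 + 1)) 0
  | quad_t0 : Rel q a b c (letter t0 * (letter t0 + 1)) 0
  | quad_t1x : Rel q a b c
      ((letter t1 * letter x + scal a) * (letter t1 * letter x + scal b)) 0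
  | cross : Rel q a b c
      (scal q * letter t0 * letter xinv + scal c) (letter x * (letter t0 + 1))

/-- The confluent Cherednik algebra `H_V`, the associative unital complex algebra presented by
the generators `Gen` and the relations `Rel q a b c`. -/
abbrev HV (q a b c : ℂ) : Type := RingQuot (Rel q a b c)

/-- The image in `H_V` of a generator. -/
def HV.gen (q a b c : ℂ) (g : Gen) : HV q a b c := RingQuot.mkAlgHom ℂ (Rel q a b c) (letter g)

/-- For a nonzero scalar `r` and a Laurent polynomial `f = ∑ₙ fₙ zⁿ`, the Laurent polynomial
`f[r z⁻¹] = ∑ₙ fₙ rⁿ z⁻ⁿ`. -/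
def reflect (r : ℂ) (f : ℂ[T;T⁻¹]) : ℂ[T;T⁻¹] :=
  f.coeff.sum fun n k => LaurentPolynomial.C (k * r ^ n) * LaurentPolynomial.T (-n)

/-- The field of rational functions in `z`, as the fraction field of the Laurent polynomials. -/
abbrev RatFun : Type := FractionRing ℂ[T;T⁻¹]

/-- A Laurent polynomial, seen as a rational function. -/
def toRat (f : ℂ[T;T⁻¹]) : RatFun := algebraMap ℂ[T;T⁻¹] RatFun f

/-- The rational function `z`. -/
def z : RatFun := toRat (LaurentPolynomial.T 1)

/-- A constant rational function. -/
def con (k : ℂ) : RatFun := toRat (LaurentPolynomial.C k)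

end

end ConfluentCherednik

/-! Write σ_r for f[z] ↦ f[r z⁻¹] and D_r = (1 - σ_r)/(r - z²), which preserves Laurent polynomials.
Then T₀ = (z - c) z D_q and T₁ = -ab - (1 - az)(1 - bz) D_1, and the defining relations become
identities for D_q and D_1; this gives `polyRep`.

Faithfulness rests on the combinations ∑ pₙ(X) wₙ, where the wₙ are the alternating words in T₀ and
T₁. In H_V they exhaust the algebra, because the relations move T₀ and T₁ to the right of X and
shorten repeated letters (`HV.ofNormalForm_surjective`). As an operator, wₙ expands over the
rational functions in the substitutions of the infinite dihedral group ⟨σ_q, σ_1⟩, with a nonzero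
coefficient at index n and all others at smaller length (`exists_expansion_dihedralWord`). As q is
not a root of unity, these substitutions are distinct, hence linearly independent by Dedekind's
lemma, and triangularity forces every pₙ to vanish (`eq_zero_of_sum_mul_dihedralWord_eq_zero`). -/

namespace ConfluentCherednik

noncomputable section

open LaurentPolynomial

/-! ### Monomial substitutions in Laurent polynomials -/

/-- The algebra homomorphism from Laurent polynomials sending `z` to a given unit. -/
def evalUnit {A : Type*} [Ring A] [Algebra ℂ A] (u : Aˣ) : ℂ[T;T⁻¹] →ₐ[ℂ] A :=
  AddMonoidAlgebra.lift ℂ A ℤ ((Units.coeHom A).comp (zpowersHom Aˣ u))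

theorem evalUnit_T {A : Type*} [Ring A] [Algebra ℂ A] (u : Aˣ) (n : ℤ) :
    evalUnit u (T n) = ((u ^ n : Aˣ) : A) := by
  rw [evalUnit, T, AddMonoidAlgebra.lift_single]
  simp

theorem laurent_algHom_ext {A : Type*} [Ring A] [Algebra ℂ A] {φ ψ : ℂ[T;T⁻¹] →ₐ[ℂ] A}
    (h : φ (T 1) = ψ (T 1)) : φ = ψ := by
  have inv (χ : ℂ[T;T⁻¹] →ₐ[ℂ] A) : χ (T 1) * χ (T (-1)) = 1 ∧ χ (T (-1)) * χ (T 1) = 1 := by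
    rw [← map_mul, ← map_mul, ← T_add, ← T_add, add_neg_cancel, neg_add_cancel, T_zero, map_one]
    exact ⟨rfl, rfl⟩
  have h' : φ (T (-1)) = ψ (T (-1)) :=
    left_inv_eq_right_inv (inv φ).2 (by rw [h]; exact (inv ψ).1)
  refine AlgHom.ext fun f => ?_
  induction f using LaurentPolynomial.induction_on with
  | h_C a => rw [C_eq_algebraMap, AlgHom.commutes, AlgHom.commutes]
  | h_add hp hq => simp [hp, hq]
  | h_C_mul_T n a ih => rw [T_add, ← mul_assoc, map_mul, ih, h, ← map_mul]
  | h_C_mul_T_Z n a ih => rw [T_sub, ← mul_assoc, map_mul, ih, h', ← map_mul]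

/-- The unit `r zⁿ` of the Laurent polynomials. -/
def monomialUnit (r : ℂˣ) (n : ℤ) : ℂ[T;T⁻¹]ˣ where
  val := C (r : ℂ) * T n
  inv := C ((r⁻¹ : ℂˣ) : ℂ) * T (-n)
  val_inv := by
    rw [mul_mul_mul_comm, ← map_mul, ← T_add]; simp
  inv_val := by
    rw [mul_mul_mul_comm, ← map_mul, ← T_add]; simp

/-- The substitution `f[z] ↦ f[r zⁿ]`. -/
def subst (r : ℂˣ) (n : ℤ) : ℂ[T;T⁻¹] →ₐ[ℂ] ℂ[T;T⁻¹] := evalUnit (monomialUnit r n)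

theorem monomialUnit_zpow (r : ℂˣ) (n k : ℤ) :
    monomialUnit r n ^ k = monomialUnit (r ^ k) (n * k) := by
  have mul (r s : ℂˣ) (m n : ℤ) :
      monomialUnit r m * monomialUnit s n = monomialUnit (r * s) (m + n) := by
    ext1
    simp only [monomialUnit, Units.val_mul, map_mul, T_add]
    ring
  have pow (n : ℤ) (k : ℕ) : monomialUnit r n ^ k = monomialUnit (r ^ k) (n * k) := by
    induction k with
    | zero => ext1; simp [monomialUnit]
    | succ k ih => rw [pow_succ, ih, mul]; push_cast; rw [pow_succ, mul_add, mul_one]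
  obtain ⟨k, rfl | rfl⟩ := k.eq_nat_or_neg
  · simpa using pow n k
  · rw [zpow_neg, zpow_natCast, pow, inv_eq_iff_mul_eq_one, mul]
    ext1; simp [monomialUnit]

theorem subst_T (r : ℂˣ) (n k : ℤ) :
    subst r n (T k) = C ((r ^ k : ℂˣ) : ℂ) * T (n * k) := by
  rw [subst, evalUnit_T, monomialUnit_zpow, monomialUnit]

theorem subst_C (r : ℂˣ) (n : ℤ) (k : ℂ) : subst r n (C k) = C k := by
  rw [C_eq_algebraMap, AlgHom.commutes]

theorem subst_comp (r s : ℂˣ) (m n : ℤ) :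
    (subst r m).comp (subst s n) = subst (s * r ^ n) (m * n) := by
  apply laurent_algHom_ext
  simp only [AlgHom.comp_apply, subst_T, map_mul, subst_C, zpow_one, mul_one, Units.val_mul]
  ring

theorem subst_one : subst 1 1 = AlgHom.id ℂ _ := by
  apply laurent_algHom_ext
  simp [subst_T]

theorem reflect_eq_subst (r : ℂˣ) (f : ℂ[T;T⁻¹]) : reflect r f = subst r (-1) f := by
  rw [reflect, subst, evalUnit, AddMonoidAlgebra.lift_apply]
  refine Finsupp.sum_congr fun n _ => ?_
  have := monomialUnit_zpow r (-1) n
  simp only [MonoidHom.comp_apply, zpowersHom_apply, toAdd_ofAdd, Units.coeHom_apply, this]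
  simp [monomialUnit, smul_eq_C_mul, mul_assoc]

theorem subst_reflection_involutive (r : ℂˣ) (f : ℂ[T;T⁻¹]) :
    subst r (-1) (subst r (-1) f) = f := by
  have := DFunLike.congr_fun (subst_comp r r (-1) (-1)) f
  simpa [subst_one] using this

theorem subst_reflection_injective (r : ℂˣ) : Function.Injective (subst r (-1)) :=
  (show Function.Involutive _ from subst_reflection_involutive r).injective

/-! ### Divided differences -/

theorem T_mul_T_neg : (T 1 : ℂ[T;T⁻¹]) * T (-1) = 1 := by
  rw [← T_add, add_neg_cancel, T_zero]

theorem C_mul_C_inv (r : ℂˣ) : C (r : ℂ) * C ((r⁻¹ : ℂˣ) : ℂ) = 1 := by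
  rw [← map_mul]; simp

/-- The map 1 - σ is a σ-twisted derivation, so divisibility passes to products and only z and z⁻¹
need checking. -/
theorem reflection_dvd (r : ℂˣ) (f : ℂ[T;T⁻¹]) :
    (C (r : ℂ) - T 1 ^ 2) ∣ f - subst r (-1) f := by
  have hx := T_mul_T_neg
  have hr := C_mul_C_inv r
  have h1 : (C (r : ℂ) - T 1 ^ 2) ∣ T 1 - subst r (-1) (T 1) :=
    ⟨-T (-1), by simp only [subst_T, zpow_one, mul_one]; linear_combination -T 1 * hx⟩
  have h2 : (C (r : ℂ) - T 1 ^ 2) ∣ T (-1) - subst r (-1) (T (-1)) :=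
    ⟨C ((r⁻¹ : ℂˣ) : ℂ) * T (-1), by
      simp only [subst_T, zpow_neg, zpow_one, mul_neg, mul_one, neg_neg]
      linear_combination -T (-1) * hr + C ((r⁻¹ : ℂˣ) : ℂ) * T 1 * hx⟩
  have mul (f g : ℂ[T;T⁻¹]) (hf : (C (r : ℂ) - T 1 ^ 2) ∣ f - subst r (-1) f)
      (hg : (C (r : ℂ) - T 1 ^ 2) ∣ g - subst r (-1) g) :
      (C (r : ℂ) - T 1 ^ 2) ∣ f * g - subst r (-1) (f * g) := by
    have : f * g - subst r (-1) (f * g) =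
        (f - subst r (-1) f) * g + subst r (-1) f * (g - subst r (-1) g) := by
      rw [map_mul]; ring
    rw [this]
    exact dvd_add (hf.mul_right _) (hg.mul_left _)
  induction f using LaurentPolynomial.induction_on with
  | h_C a => simp [subst_C]
  | h_add hp hq => rw [map_add, add_sub_add_comm]; exact dvd_add hp hq
  | h_C_mul_T n a ih => rw [T_add, ← mul_assoc]; exact mul _ _ ih h1
  | h_C_mul_T_Z n a ih => rw [T_sub, ← mul_assoc]; exact mul _ _ ih h2

theorem coeff_sub_T_sq_ne_zero (k : ℂ) : (C k - T 1 ^ 2 : ℂ[T;T⁻¹]) ≠ 0 := by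
  intro h
  have := congrArg (fun f : ℂ[T;T⁻¹] => f.coeff 2) h
  simp [T_pow] at this

/-- The divided difference `(f[z] - f[r z⁻¹]) / (r - z²)`. -/
def divDiff (r : ℂˣ) : ℂ[T;T⁻¹] →ₗ[ℂ] ℂ[T;T⁻¹] where
  toFun f := (reflection_dvd r f).choose
  map_add' f g := by
    apply mul_left_cancel₀ (coeff_sub_T_sq_ne_zero (r : ℂ))
    rw [mul_add, ← (reflection_dvd r (f + g)).choose_spec, ← (reflection_dvd r f).choose_spec,
      ← (reflection_dvd r g).choose_spec, map_add]
    ring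
  map_smul' k f := by
    apply mul_left_cancel₀ (coeff_sub_T_sq_ne_zero (r : ℂ))
    rw [RingHom.id_apply, mul_smul_comm, ← (reflection_dvd r (k • f)).choose_spec,
      ← (reflection_dvd r f).choose_spec, map_smul, smul_sub]

theorem mul_divDiff (r : ℂˣ) (f : ℂ[T;T⁻¹]) :
    (C (r : ℂ) - T 1 ^ 2) * divDiff r f = f - subst r (-1) f :=
  (reflection_dvd r f).choose_spec.symm

/-- Apply σ to (r - z²) D f = f - σf: the right side changes sign, and σ(r - z²) = -r z⁻² (r - z²).
-/
theorem subst_divDiff (r : ℂˣ) (f : ℂ[T;T⁻¹]) :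
    subst r (-1) (divDiff r f) = C ((r⁻¹ : ℂˣ) : ℂ) * T 1 ^ 2 * divDiff r f := by
  have hx := T_mul_T_neg
  have hr := C_mul_C_inv r
  have h := mul_divDiff r f
  have h' := congrArg (subst r (-1)) h
  rw [map_mul, map_sub, map_sub, subst_reflection_involutive, map_pow, subst_C, subst_T] at h'
  simp only [zpow_one, mul_one] at h'
  apply mul_left_cancel₀ (coeff_sub_T_sq_ne_zero (r : ℂ))
  generalize subst r (-1) (divDiff r f) = d at *
  generalize divDiff r f = e at *
  generalize subst r (-1) f = g at *
  generalize C (r : ℂ) = k at *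
  generalize C ((r⁻¹ : ℂˣ) : ℂ) = l at *
  generalize (T 1 : ℂ[T;T⁻¹]) = x at *
  generalize (T (-1) : ℂ[T;T⁻¹]) = y at *
  grind

theorem divDiff_mul (r : ℂˣ) (f g : ℂ[T;T⁻¹]) :
    divDiff r (f * g) = divDiff r f * g + subst r (-1) f * divDiff r g := by
  apply mul_left_cancel₀ (coeff_sub_T_sq_ne_zero (r : ℂ))
  rw [mul_divDiff, map_mul]
  linear_combination -g * mul_divDiff r f - subst r (-1) f * mul_divDiff r g

/-! ### The operators and the defining relations -/

/-- The operator `T₀`. -/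
def opT0 (q : ℂˣ) (c : ℂ) : Module.End ℂ ℂ[T;T⁻¹] :=
  LinearMap.mulLeft ℂ ((T 1 - C c) * T 1) ∘ₗ divDiff q

/-- The operator `T₁`. -/
def opT1 (a b : ℂ) : Module.End ℂ ℂ[T;T⁻¹] :=
  LinearMap.mulLeft ℂ (-C (a * b)) -
    LinearMap.mulLeft ℂ ((1 - C a * T 1) * (1 - C b * T 1)) ∘ₗ divDiff 1

theorem opT0_apply (q : ℂˣ) (c : ℂ) (f : ℂ[T;T⁻¹]) :
    opT0 q c f = (T 1 - C c) * T 1 * divDiff q f := rfl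

theorem opT1_apply (a b : ℂ) (f : ℂ[T;T⁻¹]) :
    opT1 a b f = -C a * C b * f - (1 - C a * T 1) * (1 - C b * T 1) * divDiff 1 f := by
  simp [opT1, mul_assoc]

/-- With e = D f, `subst_divDiff` gives σ((z - c) z e) = (q - cz) e, so D((z - c) z e) = -e. -/
theorem opT0_quadratic (q : ℂˣ) (c : ℂ) (f : ℂ[T;T⁻¹]) :
    opT0 q c (opT0 q c f + f) = 0 := by
  have hx := T_mul_T_neg
  have hr := C_mul_C_inv q
  have h := subst_divDiff q f
  have h0 := mul_divDiff q f
  have h1 := mul_divDiff q ((T 1 - C c) * T 1 * divDiff q f)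
  simp only [opT0_apply, map_add]
  simp only [map_mul, map_sub, subst_C, subst_T, h, zpow_one, mul_one] at h1
  apply mul_left_cancel₀ (coeff_sub_T_sq_ne_zero (q : ℂ))
  generalize divDiff q ((T 1 - C c) * T 1 * divDiff q f) = d at *
  generalize divDiff q f = e at *
  generalize C (q : ℂ) = k at *
  generalize C ((q⁻¹ : ℂˣ) : ℂ) = l at *
  generalize (T 1 : ℂ[T;T⁻¹]) = x at *
  generalize (T (-1) : ℂ[T;T⁻¹]) = y at *
  generalize C c = c at *
  grind

theorem opT0_cross (q : ℂˣ) (c : ℂ) (f : ℂ[T;T⁻¹]) :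
    C (q : ℂ) * opT0 q c (T (-1) * f) + C c * f = T 1 * (opT0 q c f + f) := by
  have hx := T_mul_T_neg
  have hr := C_mul_C_inv q
  have h0 := mul_divDiff q f
  have h1 := mul_divDiff q (T (-1) * f)
  simp only [opT0_apply]
  simp only [map_mul, subst_T, zpow_neg, zpow_one, mul_neg, mul_one, neg_neg] at h1
  apply mul_left_cancel₀ (coeff_sub_T_sq_ne_zero (q : ℂ))
  generalize divDiff q (T (-1) * f) = d at *
  generalize divDiff q f = e at *
  generalize subst q (-1) f = g at *
  generalize C (q : ℂ) = k at *
  generalize C ((q⁻¹ : ℂˣ) : ℂ) = l at *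
  generalize (T 1 : ℂ[T;T⁻¹]) = x at *
  generalize (T (-1) : ℂ[T;T⁻¹]) = y at *
  generalize C c = c at *
  grind

/-- With w = (1 - az)(1 - bz) and e = D f, `subst_divDiff` gives σ(w e) = (z - a)(z - b) e, hence
D(w e) = (1 - ab) e. So D kills (T₁ + 1) f = (1 - ab) f - w e, while T₁ + ab = -w D. -/
theorem opT1_quadratic (a b : ℂ) (f : ℂ[T;T⁻¹]) :
    opT1 a b (opT1 a b f + f) + C a * C b * (opT1 a b f + f) = 0 := by
  have hx := T_mul_T_neg
  have h := subst_divDiff 1 f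
  have h0 := mul_divDiff 1 f
  have h1 := mul_divDiff 1 (opT1 a b f + f)
  have hne := coeff_sub_T_sq_ne_zero 1
  rw [opT1_apply a b (opT1 a b f + f)]
  simp only [opT1_apply, map_add, map_mul, map_sub, map_neg, map_one, subst_C, subst_T, h, zpow_one,
    mul_one, Units.val_one, inv_one, one_mul] at h1 h0 hne ⊢
  apply mul_left_cancel₀ hne
  generalize (T 1 : ℂ[T;T⁻¹]) = x at *
  generalize (T (-1) : ℂ[T;T⁻¹]) = y at *
  generalize C a = a at *
  generalize C b = b at *
  generalize subst 1 (-1) f = g at *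
  generalize divDiff 1 f = e at *
  have hg : g = f - (1 - x ^ 2) * e := by linear_combination h0
  subst hg
  grind

/-- By `key`, T₁X + a = z⁻¹(1 - bz)(1 - (1 - az) D), and likewise with a and b exchanged. So u =
(T₁X + b) f equals (z⁻¹ - a) v with v = f - (1 - bz) D f. This v is σ-invariant, hence D u = z⁻¹ v
and (1 - (1 - az) D) u = 0. -/
theorem opT1_mul_T_quadratic (a b : ℂ) (f : ℂ[T;T⁻¹]) :
    opT1 a b (T 1 * (opT1 a b (T 1 * f) + C b * f)) +
      C a * (opT1 a b (T 1 * f) + C b * f) = 0 := by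
  have hx := T_mul_T_neg
  have hT : divDiff 1 (T 1) = -T (-1) := by
    apply mul_left_cancel₀ (coeff_sub_T_sq_ne_zero ((1 : ℂˣ) : ℂ))
    rw [mul_divDiff, subst_T]
    simp only [zpow_one, Units.val_one, map_one, one_mul, mul_one]
    linear_combination -T 1 * hx
  have key (g : ℂ[T;T⁻¹]) : opT1 a b (T 1 * g) = (T (-1) - C a - C b) * g
      - (1 - C a * T 1) * (1 - C b * T 1) * T (-1) * divDiff 1 g := by
    rw [opT1_apply, divDiff_mul, hT, subst_T]
    simp only [zpow_one, Units.val_one, map_one, one_mul, mul_one]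
    linear_combination (-C a - C b) * g * hx + C a * C b * T 1 * g * hx
  set u := opT1 a b (T 1 * f) + C b * f with hu
  rw [key] at hu
  rw [key]
  have h := subst_divDiff 1 f
  have h0 := mul_divDiff 1 f
  have h1 := mul_divDiff 1 u
  have hne := coeff_sub_T_sq_ne_zero 1
  apply mul_left_cancel₀ hne
  generalize hd : divDiff 1 u = d at *
  rw [hu] at h1
  simp only [map_add, map_mul, map_sub, map_one, subst_C, subst_T, h, zpow_one, zpow_neg,
    mul_one, Units.val_one, inv_one, one_mul, mul_neg, neg_neg] at h1 h0 hne ⊢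
  generalize (T 1 : ℂ[T;T⁻¹]) = x at *
  generalize (T (-1) : ℂ[T;T⁻¹]) = y at *
  generalize C a = a at *
  generalize C b = b at *
  generalize subst 1 (-1) f = g at *
  generalize divDiff 1 f = e at *
  have hg : g = f - (1 - x ^ 2) * e := by linear_combination h0
  clear_value u
  subst hg hu
  clear hd key hT h h0
  grind

/-- The images of the generators in the polynomial representation. -/
def genOp (q : ℂˣ) (a b c : ℂ) : Gen → Module.End ℂ ℂ[T;T⁻¹]
  | Gen.t0 => opT0 q c
  | Gen.t1 => opT1 a b
  | Gen.x => LinearMap.mulLeft ℂ (T 1)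
  | Gen.xinv => LinearMap.mulLeft ℂ (T (-1))

theorem lift_genOp_rel (q : ℂˣ) (a b c : ℂ) ⦃u v : FreeAlgebra ℂ Gen⦄ (h : Rel q a b c u v) :
    FreeAlgebra.lift ℂ (genOp q a b c) u = FreeAlgebra.lift ℂ (genOp q a b c) v := by
  have hx := T_mul_T_neg
  refine LinearMap.ext fun f => ?_
  cases h with
  | x_mul_xinv =>
    simp only [letter, map_mul, FreeAlgebra.lift_ι_apply, genOp, map_one, Module.End.mul_apply,
      LinearMap.mulLeft_apply, Module.End.one_apply]
    linear_combination f * hx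
  | xinv_mul_x =>
    simp only [letter, map_mul, FreeAlgebra.lift_ι_apply, genOp, map_one, Module.End.mul_apply,
      LinearMap.mulLeft_apply, Module.End.one_apply]
    linear_combination f * hx
  | quad_t1 =>
    have := opT1_quadratic a b f
    simp only [letter, scal, map_mul, map_add, FreeAlgebra.lift_ι_apply, genOp, map_one, map_zero,
      Module.End.mul_apply, LinearMap.add_apply, Module.End.one_apply, LinearMap.zero_apply,
      AlgHom.commutes, Module.algebraMap_end_apply, smul_eq_C_mul] at this ⊢
    linear_combination this
  | quad_t0 =>
    have := opT0_quadratic q c f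
    simpa only [letter, scal, map_mul, map_add, FreeAlgebra.lift_ι_apply, genOp, map_one, map_zero,
      Module.End.mul_apply, LinearMap.add_apply, Module.End.one_apply, LinearMap.zero_apply]
      using this
  | quad_t1x =>
    have := opT1_mul_T_quadratic a b f
    simp only [letter, scal, map_mul, map_add, FreeAlgebra.lift_ι_apply, genOp, map_zero, mul_add,
      Module.End.mul_apply, LinearMap.add_apply, LinearMap.zero_apply, AlgHom.commutes,
      Module.algebraMap_end_apply, smul_eq_C_mul, LinearMap.mulLeft_apply] at this ⊢
    linear_combination this
  | cross =>
    have := opT0_cross q c f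
    simp only [letter, scal, map_mul, map_add, FreeAlgebra.lift_ι_apply, genOp, map_one, mul_add,
      Module.End.mul_apply, LinearMap.add_apply, Module.End.one_apply, AlgHom.commutes,
      Module.algebraMap_end_apply, smul_eq_C_mul, LinearMap.mulLeft_apply] at this ⊢
    linear_combination this

/-- The polynomial representation of `H_V`. -/
def polyRep (q : ℂˣ) (a b c : ℂ) : HV q a b c →ₐ[ℂ] Module.End ℂ ℂ[T;T⁻¹] :=
  RingQuot.liftAlgHom ℂ ⟨FreeAlgebra.lift ℂ (genOp q a b c), lift_genOp_rel q a b c⟩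

theorem polyRep_gen (q : ℂˣ) (a b c : ℂ) (g : Gen) :
    polyRep q a b c (HV.gen q a b c g) = genOp q a b c g := by
  rw [polyRep, HV.gen, RingQuot.liftAlgHom_mkAlgHom_apply, letter, FreeAlgebra.lift_ι_apply]

/-! ### The operators over the rational functions -/

theorem toRat_injective : Function.Injective toRat :=
  IsFractionRing.injective ℂ[T;T⁻¹] RatFun

theorem con_sub_z_sq_ne_zero (k : ℂ) : con k - z ^ 2 ≠ 0 := by
  intro h
  apply coeff_sub_T_sq_ne_zero k
  apply toRat_injective
  simpa [toRat, con, z, -T_pow] using h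

theorem toRat_divDiff (r : ℂˣ) (f : ℂ[T;T⁻¹]) :
    toRat (divDiff r f) = (toRat f - toRat (subst r (-1) f)) / (con r - z ^ 2) := by
  rw [eq_div_iff (con_sub_z_sq_ne_zero r), mul_comm]
  simpa [toRat, con, z, -T_pow] using congrArg toRat (mul_divDiff r f)

theorem toRat_opT0 (q : ℂˣ) (c : ℂ) (f : ℂ[T;T⁻¹]) :
    toRat (opT0 q c f) =
      (z - con c) * z / (con q - z ^ 2) * (toRat f - toRat (subst q (-1) f)) := by
  have : toRat (opT0 q c f) = (z - con c) * z * toRat (divDiff q f) := by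
    simp [opT0_apply, toRat, con, z]
  rw [this, toRat_divDiff]
  ring

theorem one_sub_z_sq_ne_zero : 1 - z ^ 2 ≠ 0 := by
  simpa [con, toRat] using con_sub_z_sq_ne_zero 1

/-- The two forms agree because (a + b) z - (1 + ab) + (1 - az)(1 - bz) = -ab (1 - z²). -/
theorem toRat_opT1 (a b : ℂ) (f : ℂ[T;T⁻¹]) :
    toRat (opT1 a b f) =
      ((con a + con b) * z - (1 + con a * con b)) / (1 - z ^ 2) * toRat f +
        (1 - con a * z) * (1 - con b * z) / (1 - z ^ 2) * toRat (subst 1 (-1) f) := by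
  have h : toRat (opT1 a b f) = -con a * con b * toRat f -
      (1 - con a * z) * (1 - con b * z) * toRat (divDiff 1 f) := by
    simp [opT1_apply, toRat, con, z]
  have h1 : con ((1 : ℂˣ) : ℂ) = 1 := by simp [con, toRat]
  have := one_sub_z_sq_ne_zero
  rw [h, toRat_divDiff, h1]
  field_simp
  ring

/-! ### Alternating words -/

/-- The alternating word `t u t ⋯` of length `n`. -/
def altWord {A : Type*} [Monoid A] (t u : A) : ℕ → A
  | 0 => 1
  | n + 1 => t * altWord u t n

/-- The alternating words in `t` and `u`, indexed by the integers: the word of index `n` has length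
`|n|`, and starts with `t` if `0 < n` and with `u` if `n < 0`. -/
def dihedralWord {A : Type*} [Monoid A] (t u : A) : ℤ → A
  | Int.ofNat n => altWord t u n
  | Int.negSucc n => altWord u t (n + 1)

section Words

variable {A : Type*} [Monoid A] (t u : A)

theorem dihedralWord_zero : dihedralWord t u 0 = 1 := rfl

theorem dihedralWord_natCast (n : ℕ) : dihedralWord t u n = altWord t u n := rfl

theorem dihedralWord_neg_natCast (n : ℕ) : dihedralWord t u (-n) = altWord u t n := by
  cases n with
  | zero => rfl
  | succ n => rfl

theorem mul_dihedralWord_of_nonpos {n : ℤ} (hn : n ≤ 0) :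
    t * dihedralWord t u n = dihedralWord t u (1 - n) := by
  obtain ⟨k, rfl⟩ : ∃ k : ℕ, n = -k := ⟨n.natAbs, by omega⟩
  rw [dihedralWord_neg_natCast, show 1 - (-k : ℤ) = (k + 1 : ℕ) by push_cast; ring,
    dihedralWord_natCast, altWord]

theorem mul_dihedralWord_of_nonneg {n : ℤ} (hn : 0 ≤ n) :
    u * dihedralWord t u n = dihedralWord t u (-1 - n) := by
  obtain ⟨k, rfl⟩ := Int.eq_ofNat_of_zero_le hn
  rw [dihedralWord_natCast, show -1 - (k : ℤ) = -(k + 1 : ℕ) by push_cast; ring,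
    dihedralWord_neg_natCast, altWord]

/-- The two steps are left multiplication by `t` and by `u`, in the cases where it lengthens the
word. -/
theorem dihedralWord_induction {P : ℤ → Prop} (zero : P 0)
    (left : ∀ n ≤ 0, P n → P (1 - n)) (right : ∀ n, 0 ≤ n → P n → P (-1 - n)) (n : ℤ) : P n := by
  have key (k : ℕ) : P k ∧ P (-k) := by
    induction k with
    | zero => exact ⟨zero, zero⟩
    | succ k ih =>
      have h1 := left (-k) (by omega) ih.2
      have h2 := right k (by omega) ih.1
      exact ⟨by convert h1 using 1; push_cast; ring, by convert h2 using 1; push_cast; ring⟩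
  obtain ⟨k, rfl | rfl⟩ := n.eq_nat_or_neg
  exacts [(key k).1, (key k).2]

end Words

/-! ### The dihedral substitutions and their independence -/

/-- The substitutions by which the infinite dihedral group generated by `f[z] ↦ f[q z⁻¹]` and
`f[z] ↦ f[z⁻¹]` acts, indexed as the alternating words. -/
def dihedralSubst (q : ℂˣ) (n : ℤ) : ℂ[T;T⁻¹] →ₐ[ℂ] ℂ[T;T⁻¹] :=
  if Even n then subst (q ^ (-(n / 2))) 1 else subst (q ^ ((n + 1) / 2)) (-1)

/-- The reflections σ_q and σ_1 move the index by n ↦ 1 - n and n ↦ -1 - n, exactly as the letters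
move the index of a word they lengthen. -/
theorem subst_comp_dihedralSubst (q : ℂˣ) (n : ℤ) :
    (subst q (-1)).comp (dihedralSubst q n) = dihedralSubst q (1 - n) := by
  rcases Int.even_or_odd' n with ⟨k, rfl | rfl⟩
  · rw [dihedralSubst, dihedralSubst, if_pos (by simp), if_neg (by simp [Int.even_sub]), subst_comp,
      ← zpow_add]
    congr 2
    omega
  · rw [dihedralSubst, dihedralSubst, if_neg (by simp [parity_simps]),
      if_pos (by simp [parity_simps]), subst_comp, ← zpow_add]
    congr 2
    omega

theorem subst_one_comp_dihedralSubst (q : ℂˣ) (n : ℤ) :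
    (subst 1 (-1)).comp (dihedralSubst q n) = dihedralSubst q (-1 - n) := by
  rcases Int.even_or_odd' n with ⟨k, rfl | rfl⟩
  · rw [dihedralSubst, dihedralSubst, if_pos (by simp), if_neg (by simp [parity_simps]), subst_comp,
      one_zpow, mul_one]
    congr 2
    omega
  · rw [dihedralSubst, dihedralSubst, if_neg (by simp [parity_simps]),
      if_pos (by simp [parity_simps]), subst_comp, one_zpow, mul_one]
    congr 2
    omega

theorem subst_injective {r s : ℂˣ} {m n : ℤ} (h : subst r m = subst s n) : r = s ∧ m = n := by
  have h := DFunLike.congr_fun h (T 1)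
  simp only [subst_T, zpow_one, mul_one] at h
  rw [← single_eq_C_mul_T, ← single_eq_C_mul_T] at h
  have hm := congrArg (fun f : ℂ[T;T⁻¹] => f.coeff m) h
  simp only [AddMonoidAlgebra.coeff_single, Finsupp.single_apply] at hm
  by_cases hmn : n = m
  · subst hmn
    simp only [if_true] at hm
    exact ⟨Units.ext hm, rfl⟩
  · simp [hmn] at hm

theorem dihedralSubst_injective {q : ℂˣ} (hq : Function.Injective fun n : ℤ => q ^ n) :
    Function.Injective (dihedralSubst q) := by
  intro m n h
  unfold dihedralSubst at h
  split_ifs at h with hm hn hn <;> obtain ⟨h1, h2⟩ := subst_injective h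
  · have := hq h1
    rw [Int.even_iff] at hm hn
    omega
  · omega
  · omega
  · have := hq h1
    rw [Int.even_iff] at hm hn
    omega

theorem zpow_injective_of_forall_pow_ne_one {q : ℂˣ} (hq : ∀ m : ℕ, 1 ≤ m → (q : ℂ) ^ m ≠ 1) :
    Function.Injective fun n : ℤ => q ^ n := by
  rw [injective_zpow_iff_not_isOfFinOrder, isOfFinOrder_iff_pow_eq_one]
  rintro ⟨n, hn, h⟩
  exact hq n hn (by rw [← Units.val_pow_eq_pow_val, h, Units.val_one])

/-- The dihedral substitutions, with values in the rational functions. -/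
def dihedralEval (q : ℂˣ) (n : ℤ) (f : ℂ[T;T⁻¹]) : RatFun := toRat (dihedralSubst q n f)

/-- Dedekind's independence of distinct multiplicative characters. -/
theorem linearIndependent_dihedralEval {q : ℂˣ} (hq : Function.Injective fun n : ℤ => q ^ n) :
    LinearIndependent RatFun (dihedralEval q) := by
  let φ (n : ℤ) : ℂ[T;T⁻¹] →* RatFun :=
    ((algebraMap ℂ[T;T⁻¹] RatFun : ℂ[T;T⁻¹] →+* RatFun) : ℂ[T;T⁻¹] →* RatFun).comp
      ((dihedralSubst q n : ℂ[T;T⁻¹] →+* ℂ[T;T⁻¹]) : ℂ[T;T⁻¹] →* ℂ[T;T⁻¹])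
  have hφ : Function.Injective φ := by
    intro m n h
    apply dihedralSubst_injective hq
    refine AlgHom.ext fun f => ?_
    exact toRat_injective (DFunLike.congr_fun h f)
  exact (linearIndependent_monoidHom ℂ[T;T⁻¹] RatFun).comp φ hφ

/-! ### Triangular expansion of the words -/

/-- The reflection `f[z] ↦ f[r z⁻¹]` of the rational functions. -/
def ratReflect (r : ℂˣ) : RatFun →+* RatFun :=
  IsFractionRing.map (j := (subst r (-1) : ℂ[T;T⁻¹] →+* ℂ[T;T⁻¹]))
    (subst_reflection_injective r)

theorem ratReflect_toRat (r : ℂˣ) (f : ℂ[T;T⁻¹]) :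
    ratReflect r (toRat f) = toRat (subst r (-1) f) :=
  IsLocalization.map_eq (nonZeroDivisors_le_comap_nonZeroDivisors_of_injective _
    (subst_reflection_injective r)) f

/-- The finitely supported family `κ` has a nonzero term at `n`, and its other terms are at
integers of smaller absolute value. -/
def HasLeadingIndex (n : ℤ) (κ : ℤ →₀ RatFun) : Prop :=
  κ n ≠ 0 ∧ ∀ m, m ≠ n → |n| ≤ |m| → κ m = 0

/-- The new coefficient at m is α κₘ + β σ(κ_{d-m}). At m = d - n the first term vanishes, as d - n
is longer than n, which leaves β σ(κₙ) ≠ 0. The letters use d = 1 and d = -1. -/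
theorem exists_expansion_reflection_operator {q r : ℂˣ} {α β : RatFun} (hβ : β ≠ 0)
    {A B : Module.End ℂ ℂ[T;T⁻¹]} {d n : ℤ}
    (hA : ∀ f, toRat (A f) = α * toRat f + β * toRat (subst r (-1) f))
    (hr : ∀ m, (subst r (-1)).comp (dihedralSubst q m) = dihedralSubst q (d - m))
    (hn : |d - n| = |n| + 1) (hd : ∀ m, |m| ≤ |d - m| + 1)
    (hB : ∃ κ, HasLeadingIndex n κ ∧
      ∀ f, toRat (B f) = Finsupp.linearCombination RatFun (dihedralEval q) κ f) :
    ∃ κ, HasLeadingIndex (d - n) κ ∧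
      ∀ f, toRat ((A * B) f) = Finsupp.linearCombination RatFun (dihedralEval q) κ f := by
  obtain ⟨κ, ⟨hκ, hκ'⟩, hB⟩ := hB
  -- The coefficients are rational functions of z, so the reflection acts on them too.
  let κr := κ.mapRange (ratReflect r) (map_zero _)
  have hval (m : ℤ) : (α • κ + β • Finsupp.equivMapDomain (Equiv.subLeft d) κr) m =
      α * κ m + β * ratReflect r (κ (d - m)) := by
    simp [κr, Finsupp.equivMapDomain_apply, Equiv.subLeft]
    left
    congr 2
    ring
  refine ⟨α • κ + β • Finsupp.equivMapDomain (Equiv.subLeft d) κr, ⟨?_, fun m hm hle => ?_⟩,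
    fun f => ?_⟩
  · rw [hval, hκ' (d - n) (fun h => by rw [h] at hn; omega) (by omega), mul_zero, zero_add,
      sub_sub_cancel]
    exact mul_ne_zero hβ ((map_ne_zero _).2 hκ)
  · have := hd m
    rw [hval, hκ' m (by rintro rfl; omega) (by omega), hκ' (d - m) (by omega) (by omega)]
    simp
  · have h1 : toRat (subst r (-1) (B f)) =
        Finsupp.linearCombination RatFun (dihedralEval q)
          (Finsupp.equivMapDomain (Equiv.subLeft d) κr) f := by
      rw [← ratReflect_toRat, hB, Finsupp.linearCombination_equivMapDomain,
        Finsupp.linearCombination_apply, Finsupp.linearCombination_apply,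
        Finsupp.sum_mapRange_index (by simp), Finsupp.sum, Finsupp.sum, Finset.sum_apply,
        Finset.sum_apply, map_sum]
      refine Finset.sum_congr rfl fun m _ => ?_
      simp only [Pi.smul_apply, smul_eq_mul, map_mul, Function.comp_apply, dihedralEval,
        ratReflect_toRat, Equiv.subLeft_apply, ← hr]
      rfl
    rw [Module.End.mul_apply, hA, h1, hB, map_add, map_smul, map_smul]
    rfl

theorem z_ne_con (k : ℂ) : z - con k ≠ 0 := by
  intro h
  have h : (T 1 : ℂ[T;T⁻¹]) = C k := toRat_injective (sub_eq_zero.1 h)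
  have := congrArg (fun f : ℂ[T;T⁻¹] => f.coeff 1) h
  simp at this

theorem z_ne_zero : z ≠ 0 := by
  simpa [con, toRat] using z_ne_con 0

theorem one_sub_con_mul_z_ne_zero (k : ℂ) : 1 - con k * z ≠ 0 := by
  intro h
  have h : (1 : ℂ[T;T⁻¹]) = C k * T 1 := by
    apply toRat_injective
    simpa [toRat, con, z, sub_eq_zero] using h
  have := congrArg (fun f : ℂ[T;T⁻¹] => f.coeff 0) h
  rw [← single_eq_C_mul_T, ← T_zero] at this
  simp only [T_apply, AddMonoidAlgebra.coeff_single, Finsupp.single_apply] at this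
  simp at this

theorem exists_expansion_dihedralWord (q : ℂˣ) (a b c : ℂ) (n : ℤ) :
    ∃ κ, HasLeadingIndex n κ ∧ ∀ f, toRat (dihedralWord (opT0 q c) (opT1 a b) n f) =
      Finsupp.linearCombination RatFun (dihedralEval q) κ f := by
  induction n using dihedralWord_induction with
  | zero =>
    refine ⟨Finsupp.single 0 1, ⟨by simp, fun m hm _ => by simp [hm.symm]⟩, fun f => ?_⟩
    simp [dihedralWord_zero, dihedralEval, dihedralSubst, subst_one]
  | left n hn ih =>
    rw [← mul_dihedralWord_of_nonpos _ _ hn]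
    have hβ : -((z - con c) * z / (con q - z ^ 2)) ≠ 0 :=
      neg_ne_zero.2 (div_ne_zero (mul_ne_zero (z_ne_con c) z_ne_zero) (con_sub_z_sq_ne_zero q))
    refine exists_expansion_reflection_operator (α := (z - con c) * z / (con q - z ^ 2)) hβ
      (fun f => ?_) (subst_comp_dihedralSubst q) (by grind) (by grind) ih
    rw [toRat_opT0]; ring
  | right n hn ih =>
    rw [← mul_dihedralWord_of_nonneg _ _ hn]
    have hβ : (1 - con a * z) * (1 - con b * z) / (1 - z ^ 2) ≠ 0 :=
      div_ne_zero (mul_ne_zero (one_sub_con_mul_z_ne_zero a) (one_sub_con_mul_z_ne_zero b))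
        one_sub_z_sq_ne_zero
    exact exists_expansion_reflection_operator hβ
      (toRat_opT1 a b) (subst_one_comp_dihedralSubst q) (by grind) (by grind) ih

theorem eq_zero_of_sum_mul_dihedralWord_eq_zero {q : ℂˣ}
    (hq : Function.Injective fun n : ℤ => q ^ n) (a b c : ℂ) (p : ℤ →₀ ℂ[T;T⁻¹])
    (hp : ∀ f, (p.sum fun n g => g * dihedralWord (opT0 q c) (opT1 a b) n f) = 0) : p = 0 := by
  by_contra hne
  choose κ hκ hκ' using exists_expansion_dihedralWord q a b c
  -- An index of maximal length: no other word in the sum contributes at n, not even the one of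
  -- index -n.
  obtain ⟨n, hn, hmax⟩ := p.support.exists_max_image (fun n => |n|)
    (Finsupp.support_nonempty_iff.2 hne)
  have hlin : Finsupp.linearCombination RatFun (dihedralEval q)
      (p.sum fun m g => toRat g • κ m) = 0 := by
    ext f
    have := congrArg toRat (hp f)
    rw [Finsupp.sum, map_sum, Finset.sum_apply]
    simp only [Finsupp.sum, toRat, map_sum, map_mul, map_zero] at this
    rw [Pi.zero_apply, ← this]
    refine Finset.sum_congr rfl fun m _ => ?_
    rw [map_smul, Pi.smul_apply, smul_eq_mul, ← hκ']
    rfl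
  have h0 := (linearIndependent_iff.1 (linearIndependent_dihedralEval hq)) _ hlin
  have h1 := DFunLike.congr_fun h0 n
  rw [Finsupp.sum, Finsupp.finsetSum_apply, Finset.sum_eq_single n] at h1
  · simp only [Finsupp.smul_apply, smul_eq_mul, Finsupp.zero_apply, mul_eq_zero, (hκ n).1,
      or_false] at h1
    exact Finsupp.mem_support_iff.1 hn (toRat_injective (h1.trans (map_zero _).symm))
  · intro m hm hmn
    rw [Finsupp.smul_apply, (hκ m).2 n hmn.symm (hmax m hm), smul_zero]
  · exact fun h => absurd hn h

/-! ### Commutation rules in a noncommutative ring -/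

section Rewriting

variable {A : Type*} [Ring A]

/-- If `t` can be moved past `z` and `z⁻¹`, then it can be moved past every Laurent polynomial. -/
theorem exists_mul_map_eq [Algebra ℂ A] {φ : ℂ[T;T⁻¹] →ₐ[ℂ] A} {t : A}
    (h1 : ∃ g h, t * φ (T 1) = φ g * t + φ h) (h2 : ∃ g h, t * φ (T (-1)) = φ g * t + φ h)
    (f : ℂ[T;T⁻¹]) : ∃ g h, t * φ f = φ g * t + φ h := by
  have mul (f f' : ℂ[T;T⁻¹]) (hf : ∃ g h, t * φ f = φ g * t + φ h)
      (hf' : ∃ g h, t * φ f' = φ g * t + φ h) : ∃ g h, t * φ (f * f') = φ g * t + φ h := by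
    obtain ⟨g, h, hf⟩ := hf
    obtain ⟨g', h', hf'⟩ := hf'
    refine ⟨g * g', g * h' + h * f', ?_⟩
    rw [map_mul, ← mul_assoc, hf, add_mul, mul_assoc, hf']
    simp only [map_mul, map_add]
    noncomm_ring
  induction f using LaurentPolynomial.induction_on with
  | h_C a =>
    refine ⟨C a, 0, ?_⟩
    rw [C_eq_algebraMap, AlgHom.commutes, map_zero, add_zero, Algebra.commutes]
  | h_add hp hq =>
    obtain ⟨g, h, hp⟩ := hp
    obtain ⟨g', h', hq⟩ := hq
    refine ⟨g + g', h + h', ?_⟩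
    simp only [map_add, mul_add, hp, hq]
    noncomm_ring
  | h_C_mul_T n a ih => rw [T_add, ← mul_assoc]; exact mul _ _ ih h1
  | h_C_mul_T_Z n a ih => rw [T_sub, ← mul_assoc]; exact mul _ _ ih h2

/-- Here p = ab and s = a + b. The difference of the two quadratic relations is t E = 0 with E = x t
x + s x - t - 1 - p. Since p is a left multiple of t, also p E = 0, and p is invertible. -/
theorem mul_x_of_quadratic {t x y s p u : A} (htt : (t + p) * (t + 1) = 0) (hyx : y * x = 1)
    (htx : t * x * (t * x) + s * (t * x) + p = 0)
    (hs : Commute s t) (hp : Commute p t) (hu : u * p = 1) :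
    t * x = y * t + y * (1 + p) - y * s * x := by
  have hp := hp.eq
  have hs := hs.eq
  have h1 : t * (x * t * x + s * x - t - 1 - p) = 0 := by
    linear_combination (norm := noncomm_ring) htx - htt - hs * x + hp
  have h2 : p * (x * t * x + s * x - t - 1 - p) = 0 := by
    have : p = -((t + 1 + p) * t) := by linear_combination (norm := noncomm_ring) htt
    rw [this, neg_mul, mul_assoc, ← this, h1, mul_zero, neg_zero]
  have h3 : x * t * x + s * x - t - 1 - p = 0 := by
    linear_combination (norm := noncomm_ring) u * h2 - hu * (x * t * x + s * x - t - 1 - p)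
  linear_combination (norm := noncomm_ring) y * h3 - hyx * (t * x)


/-- The rule for t x, multiplied by x on the left and by y on the right. -/
theorem mul_y_of_quadratic {t x y s p u : A} (htt : (t + p) * (t + 1) = 0) (hxy : x * y = 1)
    (hyx : y * x = 1) (htx : t * x * (t * x) + s * (t * x) + p = 0)
    (hs : Commute s t) (hp : Commute p t) (hu : u * p = 1) :
    t * y = x * t - (1 + p) * y + s := by
  have h := mul_x_of_quadratic htt hyx htx hs hp hu
  have h1 : x * (t * x) * y = x * (y * t + y * (1 + p) - y * s * x) * y := by rw [h]
  linear_combination (norm := noncomm_ring) -h1 + x * t * hxy - hxy * t * y - hxy * (1 + p) * y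
    + hxy * s * x * y + s * hxy

theorem mul_y_of_cross {t x y k l c : A} (h : k * t * y + c = x * (t + 1)) (hl : l * k = 1) :
    t * y = l * x * t + l * (x - c) := by
  linear_combination (norm := noncomm_ring) l * h - hl * t * y

theorem mul_x_of_cross {t x y k c : A} (h : k * t * y + c = x * (t + 1)) (hyx : y * x = 1) :
    t * x = y * k * t + (y * c * x - x) := by
  linear_combination (norm := noncomm_ring) -y * h * x + y * k * t * hyx - hyx * t * x - hyx * x

end Rewriting

/-! ### Normal forms in `H_V` -/

namespace HV

variable {q : ℂˣ} {a b c : ℂ}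

theorem x_mul_xinv : gen q a b c Gen.x * gen q a b c Gen.xinv = 1 := by
  simpa [gen] using RingQuot.mkAlgHom_rel ℂ (Rel.x_mul_xinv (q := q) (a := a) (b := b) (c := c))

theorem xinv_mul_x : gen q a b c Gen.xinv * gen q a b c Gen.x = 1 := by
  simpa [gen] using RingQuot.mkAlgHom_rel ℂ (Rel.xinv_mul_x (q := q) (a := a) (b := b) (c := c))

theorem t1_quadratic :
    (gen q a b c Gen.t1 + algebraMap ℂ _ (a * b)) * (gen q a b c Gen.t1 + 1) = 0 := by
  simpa only [gen, scal, map_mul, map_add, map_one, map_zero, AlgHom.commutes] using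
    RingQuot.mkAlgHom_rel ℂ (Rel.quad_t1 (q := q) (a := a) (b := b) (c := c))

theorem t0_quadratic : gen q a b c Gen.t0 * (gen q a b c Gen.t0 + 1) = 0 := by
  simpa only [gen, scal, map_mul, map_add, map_one, map_zero, AlgHom.commutes] using
    RingQuot.mkAlgHom_rel ℂ (Rel.quad_t0 (q := q) (a := a) (b := b) (c := c))

theorem t1_mul_x_quadratic :
    (gen q a b c Gen.t1 * gen q a b c Gen.x + algebraMap ℂ _ a) *
      (gen q a b c Gen.t1 * gen q a b c Gen.x + algebraMap ℂ _ b) = 0 := by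
  simpa only [gen, scal, map_mul, map_add, map_one, map_zero, AlgHom.commutes] using
    RingQuot.mkAlgHom_rel ℂ (Rel.quad_t1x (q := q) (a := a) (b := b) (c := c))

theorem cross :
    algebraMap ℂ _ (q : ℂ) * gen q a b c Gen.t0 * gen q a b c Gen.xinv + algebraMap ℂ _ c =
      gen q a b c Gen.x * (gen q a b c Gen.t0 + 1) := by
  simpa only [gen, scal, map_mul, map_add, map_one, map_zero, AlgHom.commutes] using
    RingQuot.mkAlgHom_rel ℂ (Rel.cross (q := q) (a := a) (b := b) (c := c))

variable (q a b c) in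
/-- The Laurent polynomials in `X`. -/
def ofLaurent : ℂ[T;T⁻¹] →ₐ[ℂ] HV q a b c :=
  evalUnit ⟨gen q a b c Gen.x, gen q a b c Gen.xinv, x_mul_xinv, xinv_mul_x⟩

theorem ofLaurent_T_one : ofLaurent q a b c (T 1) = gen q a b c Gen.x := by
  rw [ofLaurent, evalUnit_T, zpow_one]

theorem ofLaurent_T_neg_one : ofLaurent q a b c (T (-1)) = gen q a b c Gen.xinv := by
  rw [ofLaurent, evalUnit_T, zpow_neg_one]
  rfl

theorem ofLaurent_C (k : ℂ) : ofLaurent q a b c (C k) = algebraMap ℂ _ k := by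
  rw [C_eq_algebraMap, AlgHom.commutes]

theorem t0_mul_ofLaurent (f : ℂ[T;T⁻¹]) : ∃ g h, gen q a b c Gen.t0 * ofLaurent q a b c f =
    ofLaurent q a b c g * gen q a b c Gen.t0 + ofLaurent q a b c h := by
  apply exists_mul_map_eq
  · refine ⟨T (-1) * C (q : ℂ), T (-1) * C c * T 1 - T 1, ?_⟩
    simp only [map_mul, map_sub, ofLaurent_T_one, ofLaurent_T_neg_one, ofLaurent_C]
    exact mul_x_of_cross cross xinv_mul_x
  · refine ⟨C ((q⁻¹ : ℂˣ) : ℂ) * T 1, C ((q⁻¹ : ℂˣ) : ℂ) * (T 1 - C c), ?_⟩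
    simp only [map_mul, map_sub, ofLaurent_T_one, ofLaurent_T_neg_one, ofLaurent_C]
    exact mul_y_of_cross cross (by rw [← map_mul]; simp)

theorem t1_mul_ofLaurent (ha : a ≠ 0) (hb : b ≠ 0) (f : ℂ[T;T⁻¹]) :
    ∃ g h, gen q a b c Gen.t1 * ofLaurent q a b c f =
      ofLaurent q a b c g * gen q a b c Gen.t1 + ofLaurent q a b c h := by
  have hu : algebraMap ℂ (HV q a b c) (a * b)⁻¹ * algebraMap ℂ _ (a * b) = 1 := by
    rw [← map_mul, inv_mul_cancel₀ (mul_ne_zero ha hb), map_one]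
  have hs : Commute (algebraMap ℂ (HV q a b c) (a + b)) (gen q a b c Gen.t1) :=
    Algebra.commutes _ _
  have hp : Commute (algebraMap ℂ (HV q a b c) (a * b)) (gen q a b c Gen.t1) :=
    Algebra.commutes _ _
  have htx : gen q a b c Gen.t1 * gen q a b c Gen.x * (gen q a b c Gen.t1 * gen q a b c Gen.x) +
      algebraMap ℂ _ (a + b) * (gen q a b c Gen.t1 * gen q a b c Gen.x) +
      algebraMap ℂ _ (a * b) = 0 := by
    have h := t1_mul_x_quadratic (q := q) (a := a) (b := b) (c := c)
    have hb := Algebra.commutes b (gen q a b c Gen.t1 * gen q a b c Gen.x)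
    rw [map_add, map_mul]
    linear_combination (norm := noncomm_ring) h + hb
  apply exists_mul_map_eq
  · have h := mul_x_of_quadratic t1_quadratic xinv_mul_x htx hs hp hu
    refine ⟨T (-1), T (-1) * (1 + C (a * b)) - T (-1) * C (a + b) * T 1, ?_⟩
    rw [ofLaurent_T_one, h, ← ofLaurent_C, ← ofLaurent_C, ← ofLaurent_T_one, ← ofLaurent_T_neg_one,
      add_sub_assoc]
    simp only [map_mul, map_sub, map_add, map_one]
  · have h := mul_y_of_quadratic t1_quadratic x_mul_xinv xinv_mul_x htx hs hp hu
    refine ⟨T 1, C (a + b) - (1 + C (a * b)) * T (-1), ?_⟩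
    rw [ofLaurent_T_neg_one, h, ← ofLaurent_C, ← ofLaurent_C, ← ofLaurent_T_one,
      ← ofLaurent_T_neg_one]
    simp only [map_mul, map_sub, map_add, map_one]
    abel

variable (q a b c) in
/-- The alternating words in `T₀` and `T₁`. -/
def word (n : ℤ) : HV q a b c := dihedralWord (gen q a b c Gen.t0) (gen q a b c Gen.t1) n

/-- The combination of the alternating words with the given left coefficients. -/
def ofNormalForm : (ℤ →₀ ℂ[T;T⁻¹]) →+ HV q a b c :=
  Finsupp.liftAddHom fun n =>
    (AddMonoidHom.mulRight (word q a b c n)).comp (ofLaurent q a b c : _ →+ HV q a b c)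

theorem ofNormalForm_single (n : ℤ) (f : ℂ[T;T⁻¹]) :
    ofNormalForm (Finsupp.single n f) = ofLaurent q a b c f * word q a b c n := by
  simp [ofNormalForm]

theorem ofLaurent_mul_word_mem (f : ℂ[T;T⁻¹]) (n : ℤ) :
    ofLaurent q a b c f * word q a b c n ∈ (ofNormalForm (q := q) (a := a) (b := b) (c := c)).range :=
  ⟨Finsupp.single n f, ofNormalForm_single n f⟩

theorem ofLaurent_mul_mem (f : ℂ[T;T⁻¹]) {v : HV q a b c} (hv : v ∈ ofNormalForm.range) :
    ofLaurent q a b c f * v ∈ ofNormalForm.range := by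
  obtain ⟨p, rfl⟩ := hv
  induction p using Finsupp.induction_linear with
  | zero => simp
  | add p p' hp hp' => rw [map_add, mul_add]; exact add_mem hp hp'
  | single n g =>
    rw [ofNormalForm_single, ← mul_assoc, ← map_mul]
    exact ofLaurent_mul_word_mem _ _

theorem mul_mem_of_word {t : HV q a b c}
    (ht : ∀ f, ∃ g h, t * ofLaurent q a b c f = ofLaurent q a b c g * t + ofLaurent q a b c h)
    (hw : ∀ n, t * word q a b c n ∈ ofNormalForm.range) {v : HV q a b c}
    (hv : v ∈ ofNormalForm.range) : t * v ∈ ofNormalForm.range := by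
  obtain ⟨p, rfl⟩ := hv
  induction p using Finsupp.induction_linear with
  | zero => simp
  | add p p' hp hp' => rw [map_add, mul_add]; exact add_mem hp hp'
  | single n f =>
    obtain ⟨g, h, hgh⟩ := ht f
    rw [ofNormalForm_single, ← mul_assoc, hgh, add_mul, mul_assoc]
    exact add_mem (ofLaurent_mul_mem _ (hw n)) (ofLaurent_mul_word_mem _ _)

theorem word_mem (n : ℤ) : word q a b c n ∈ ofNormalForm.range := by
  simpa using ofLaurent_mul_word_mem (q := q) (a := a) (b := b) (c := c) 1 n

/-- A word not starting with T₀ gets longer; on one starting with T₀, the relation T₀² = -T₀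
applies. -/
theorem t0_mul_word_mem (n : ℤ) : gen q a b c Gen.t0 * word q a b c n ∈ ofNormalForm.range := by
  rcases le_or_gt n 0 with hn | hn
  · rw [word, mul_dihedralWord_of_nonpos _ _ hn]
    exact word_mem _
  · have h : word q a b c n = gen q a b c Gen.t0 * word q a b c (1 - n) := by
      rw [word, word, mul_dihedralWord_of_nonpos _ _ (by omega), sub_sub_cancel]
    have h0 := t0_quadratic (q := q) (a := a) (b := b) (c := c)
    have : gen q a b c Gen.t0 * word q a b c n = -word q a b c n := by
      rw [h]
      linear_combination (norm := noncomm_ring) h0 * word q a b c (1 - n)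
    rw [this]
    exact neg_mem (word_mem n)

theorem t1_mul_word_mem (n : ℤ) : gen q a b c Gen.t1 * word q a b c n ∈ ofNormalForm.range := by
  rcases le_or_gt 0 n with hn | hn
  · rw [word, mul_dihedralWord_of_nonneg _ _ hn]
    exact word_mem _
  · have h : word q a b c n = gen q a b c Gen.t1 * word q a b c (-1 - n) := by
      rw [word, word, mul_dihedralWord_of_nonneg _ _ (by omega), sub_sub_cancel]
    have h0 := t1_quadratic (q := q) (a := a) (b := b) (c := c)
    have : gen q a b c Gen.t1 * word q a b c n =
        -(ofLaurent q a b c (1 + C (a * b)) * word q a b c n +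
          ofLaurent q a b c (C (a * b)) * word q a b c (-1 - n)) := by
      rw [h, map_add, map_one, ofLaurent_C]
      linear_combination (norm := noncomm_ring) h0 * word q a b c (-1 - n)
    rw [this]
    exact neg_mem (add_mem (ofLaurent_mul_word_mem _ _) (ofLaurent_mul_word_mem _ _))

theorem gen_mul_mem (ha : a ≠ 0) (hb : b ≠ 0) (g : Gen) {v : HV q a b c}
    (hv : v ∈ ofNormalForm.range) : gen q a b c g * v ∈ ofNormalForm.range := by
  cases g with
  | t0 => exact mul_mem_of_word t0_mul_ofLaurent t0_mul_word_mem hv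
  | t1 => exact mul_mem_of_word (t1_mul_ofLaurent ha hb) t1_mul_word_mem hv
  | x => rw [← ofLaurent_T_one]; exact ofLaurent_mul_mem _ hv
  | xinv => rw [← ofLaurent_T_neg_one]; exact ofLaurent_mul_mem _ hv

/-- Every element of `H_V` is a combination of alternating words in `T₀` and `T₁`, with Laurent
polynomials in `X` as left coefficients. -/
theorem ofNormalForm_surjective (ha : a ≠ 0) (hb : b ≠ 0) :
    Function.Surjective (ofNormalForm (q := q) (a := a) (b := b) (c := c)) := by
  -- The normal forms make up a left ideal; it contains the empty word 1, so it is everything.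
  have key (w : FreeAlgebra ℂ Gen) : ∀ v ∈ (ofNormalForm (q := q) (a := a) (b := b) (c := c)).range,
      RingQuot.mkAlgHom ℂ (Rel q a b c) w * v ∈ ofNormalForm.range := by
    induction w using FreeAlgebra.induction with
    | grade0 k =>
      intro v hv
      rw [AlgHom.commutes, ← ofLaurent_C]
      exact ofLaurent_mul_mem _ hv
    | grade1 g => exact fun v hv => gen_mul_mem ha hb g hv
    | mul w w' hw hw' =>
      intro v hv
      rw [map_mul, mul_assoc]
      exact hw _ (hw' _ hv)
    | add w w' hw hw' =>
      intro v hv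
      rw [map_add, add_mul]
      exact add_mem (hw _ hv) (hw' _ hv)
  intro h
  obtain ⟨w, rfl⟩ := RingQuot.mkAlgHom_surjective ℂ (Rel q a b c) h
  simpa [word, dihedralWord_zero] using key w 1 (word_mem 0)

end HV

/-! ### Faithfulness -/

theorem map_dihedralWord {A B : Type*} [Monoid A] [Monoid B] (φ : A →* B) (t u : A) (n : ℤ) :
    φ (dihedralWord t u n) = dihedralWord (φ t) (φ u) n := by
  induction n using dihedralWord_induction with
  | zero => exact map_one φ
  | left n hn ih =>
    rw [← mul_dihedralWord_of_nonpos _ _ hn, ← mul_dihedralWord_of_nonpos _ _ hn, map_mul, ih]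
  | right n hn ih =>
    rw [← mul_dihedralWord_of_nonneg _ _ hn, ← mul_dihedralWord_of_nonneg _ _ hn, map_mul, ih]

theorem polyRep_ofLaurent (q : ℂˣ) (a b c : ℂ) (f g : ℂ[T;T⁻¹]) :
    polyRep q a b c (HV.ofLaurent q a b c f) g = f * g := by
  have : (polyRep q a b c).comp (HV.ofLaurent q a b c) = Algebra.lmul ℂ ℂ[T;T⁻¹] := by
    apply laurent_algHom_ext
    rw [AlgHom.comp_apply, HV.ofLaurent_T_one, polyRep_gen]
    rfl
  exact DFunLike.congr_fun (DFunLike.congr_fun this f) g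

theorem polyRep_ofNormalForm (q : ℂˣ) (a b c : ℂ) (p : ℤ →₀ ℂ[T;T⁻¹]) (f : ℂ[T;T⁻¹]) :
    polyRep q a b c (HV.ofNormalForm p) f =
      p.sum fun n g => g * dihedralWord (opT0 q c) (opT1 a b) n f := by
  induction p using Finsupp.induction_linear with
  | zero => simp
  | add p p' hp hp' =>
    rw [map_add, map_add, LinearMap.add_apply, hp, hp',
      Finsupp.sum_add_index' (by simp) (by intros; rw [add_mul])]
  | single n g =>
    have := map_dihedralWord (polyRep q a b c).toRingHom.toMonoidHom (HV.gen q a b c Gen.t0)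
      (HV.gen q a b c Gen.t1) n
    rw [HV.ofNormalForm_single, Finsupp.sum_single_index (by simp), map_mul, Module.End.mul_apply,
      polyRep_ofLaurent, HV.word]
    congr 2
    simpa [polyRep_gen, genOp] using this

/-- Normal forms only need to span H_V: their uniqueness is read off from their action on Laurent
polynomials. -/
theorem polyRep_injective {q : ℂˣ} (hq : Function.Injective fun n : ℤ => q ^ n) {a b : ℂ}
    (ha : a ≠ 0) (hb : b ≠ 0) (c : ℂ) : Function.Injective (polyRep q a b c) := by
  rw [injective_iff_map_eq_zero]
  intro h hh
  obtain ⟨p, rfl⟩ := HV.ofNormalForm_surjective ha hb h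
  rw [eq_zero_of_sum_mul_dihedralWord_eq_zero hq a b c p fun f => by
    rw [← polyRep_ofNormalForm, hh, LinearMap.zero_apply], map_zero]

end

end ConfluentCherednik

open ConfluentCherednik in
theorem theorem2p1 (q a b c : ℂ) (hq : q ≠ 0) (ha : a ≠ 0) (hb : b ≠ 0) (hc : c ≠ 0)
    (hroot : ∀ m : ℕ, 1 ≤ m → q ^ m ≠ 1) :
    ∃ ρ : HV q a b c →ₐ[ℂ] Module.End ℂ ℂ[T;T⁻¹],
      (∀ f : ℂ[T;T⁻¹],
        toRat (ρ (HV.gen q a b c Gen.t0) f) =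
          (z - con c) * z / (con q - z ^ 2) * (toRat f - toRat (reflect q f))) ∧
      (∀ f : ℂ[T;T⁻¹],
        toRat (ρ (HV.gen q a b c Gen.t1) f) =
          ((con a + con b) * z - (1 + con a * con b)) / (1 - z ^ 2) * toRat f +
            (1 - con a * z) * (1 - con b * z) / (1 - z ^ 2) * toRat (reflect 1 f)) ∧
      (∀ f : ℂ[T;T⁻¹],
        ρ (HV.gen q a b c Gen.x) f = LaurentPolynomial.T 1 * f) ∧
      Function.Injective ρ := by
  lift q to ℂˣ using hq.isUnit
  refine ⟨polyRep q a b c, fun f => ?_, fun f => ?_, fun f => ?_,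
    polyRep_injective (zpow_injective_of_forall_pow_ne_one hroot) ha hb c⟩
  · rw [polyRep_gen, reflect_eq_subst]
    exact toRat_opT0 q c f
  · rw [polyRep_gen, show reflect 1 f = subst 1 (-1) f from reflect_eq_subst 1 f]
    exact toRat_opT1 a b f
  · rw [polyRep_gen]
    rfl
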